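/- Let $n,N\ge 1$, $F_1\in\mathbb{R}^{n\times n}$, $F_2\in\mathbb{R}^{n\times n^2}$, and suppose $F_1=W\Lambda W^{-1}$ with $W\in\mathbb{C}^{n\times n}$ invertible and $\Lambda=\operatorname{diag}(\lambda_1,\dots,\lambda_n)$, $\operatorname{Re}\lambda_k\le 0$ for all $k$. Assume that the resonance parameter $$\Delta:=\inf_{1\le k\le n}\ \inf_{\substack{m_1,\dots,m_n\in\mathbb{Z}_{\ge0}\\ m_1+\cdots+m_n\ge 2}}\Big|\lambda_k-\sum_{j=1}^n m_j\lambda_j\Big|$$ is positive. Let $T\ge 0$, let $x:[0,T]\to\mathbb{R}^n$ solve $x'=F_1x+F_2\,(x\otimes x)$, $x(0)=x_{in}$, and suppose $\|x(t)\|_1\le\mu$ for all $t\in[0,T]$. Let $y_j:[0,T]\to\mathbb{R}^{n^j}$, $1\le j\le N$, solve the level-$N$ Carleman system $$y_j'=A_{j,j}\,y_j+A_{j,j+1}\,y_{j+1}\ (1\le j<N),\qquad y_N'=A_{N,N}\,y_N,\qquad y_j(0)=x_{in}^{\otimes j},$$ where $A_{j,j}=\sum_{i=0}^{j-1}I^{\otimes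 i}\otimes F_1\otimes I^{\otimes(j-1-i)}$ and $A_{j,j+1}=\sum_{i=0}^{j-1}I^{\otimes i}\otimes F_2\otimes I^{\otimes(j-1-i)}$. With $\|\cdot\|_1$ the $\ell^1$ vector norm and the induced matrix norm, put $\kappa_1(W)=\|W\|_1\|W^{-1}\|_1$ and $$C=\kappa_1(W)\,\|F_2\|_1\,\mu^2,\qquad \mathsf R_r=\frac{4e\,\mu\,\kappa_1(W)\,\|F_2\|_1}{\Delta}.$$ Then, if $\mathsf R_r\le 1$, $$\|x(T)-y_1(T)\|_1\le N\,C\,T\,\mathsf R_r^{\,N-1},$$ and, without any restriction on $\mathsf R_r$, $$\|x(T)-y_1(T)\|_1\le N\,C\,T\,\big(\kappa_1(W)\,\mathsf R_r\big)^{N-1}.$$ Neither $\mathsf R_r$ nor $\kappa_1(W)\mathsf R_r$ depends on $T$ other than through the uniform bound $\mu$. -/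

import Mathlib

namespace Carleman

noncomputable section

/-- The `ℓ¹` norm of a finite vector. -/
def vecNorm1 {𝕜 ι : Type*} [RCLike 𝕜] [Fintype ι] (v : ι → 𝕜) : ℝ :=
  ∑ i, ‖v i‖

/-- The matrix norm induced by the `ℓ¹` vector norms. -/
def matNorm1 {𝕜 ι κ : Type*} [RCLike 𝕜] [Fintype ι] [Fintype κ] (A : Matrix ι κ 𝕜) : ℝ :=
  sInf {c : ℝ | 0 ≤ c ∧ ∀ v : κ → 𝕜, vecNorm1 (A.mulVec v) ≤ c * vecNorm1 v}

/-- The condition number of a square matrix in the induced `ℓ¹` norm. -/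
def condNum1 {n : ℕ} (W : Matrix (Fin n) (Fin n) ℂ) : ℝ :=
  matNorm1 W * matNorm1 W⁻¹

/-- The resonance parameter of a family of eigenvalues: the infimum of `|λ_k - ∑ m_j λ_j|` over all
`k` and all multi-indices `m` of nonnegative integers with `∑ m_j ≥ 2`. -/
def resonanceParam {n : ℕ} (lam : Fin n → ℂ) : ℝ :=
  sInf {d : ℝ | ∃ (k : Fin n) (m : Fin n → ℕ), 2 ≤ ∑ j, m j ∧
    d = ‖lam k - ∑ j, (m j : ℂ) * lam j‖}

/-- The `j`-th tensor power of `v`, with coordinates indexed by multi-indices `Fin j → Fin n`. -/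
def tensorPow {n : ℕ} (v : Fin n → ℝ) (j : ℕ) : (Fin j → Fin n) → ℝ :=
  fun a => ∏ k, v (a k)

/-- The tensor square `v ⊗ v`, with coordinates indexed by pairs. -/
def tensorSq {n : ℕ} (v : Fin n → ℝ) : Fin n × Fin n → ℝ :=
  fun p => v p.1 * v p.2

/-- The diagonal block `A_{j,j} = ∑ i, I^{⊗ i} ⊗ F₁ ⊗ I^{⊗ (j-1-i)}`, `i = 0, …, j-1`. -/
def diagBlock {n : ℕ} (F₁ : Matrix (Fin n) (Fin n) ℝ) (j : ℕ) :
    Matrix (Fin j → Fin n) (Fin j → Fin n) ℝ :=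
  fun a b => ∑ i : Fin j, F₁ (a i) (b i) *
    ∏ k : Fin j, if k = i then 1 else (1 : Matrix (Fin n) (Fin n) ℝ) (a k) (b k)

/-- The superdiagonal block `A_{j,j+1} = ∑ i, I^{⊗ i} ⊗ F₂ ⊗ I^{⊗ (j-1-i)}`, `i = 0, …, j-1`.
In the `i`-th summand, `F₂` takes the tensor factors `i` and `i+1` to the factor `i`, and the
factors after `i+1` move down by one place. -/
def superBlock {n : ℕ} (F₂ : Matrix (Fin n) (Fin n × Fin n) ℝ) (j : ℕ) :
    Matrix (Fin j → Fin n) (Fin (j + 1) → Fin n) ℝ :=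
  fun a b => ∑ i : Fin j, F₂ (a i) (b i.castSucc, b i.succ) *
    ∏ k : Fin j,
      if k < i then (1 : Matrix (Fin n) (Fin n) ℝ) (a k) (b k.castSucc)
      else if i < k then (1 : Matrix (Fin n) (Fin n) ℝ) (a k) (b k.succ)
      else 1

/-- `x` solves `x' = F₁ x + F₂ (x ⊗ x)` on `[0, T]` with `x(0) = xin`. -/
def IsQuadraticSolution {n : ℕ} (F₁ : Matrix (Fin n) (Fin n) ℝ)
    (F₂ : Matrix (Fin n) (Fin n × Fin n) ℝ) (xin : Fin n → ℝ) (T : ℝ)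
    (x : ℝ → Fin n → ℝ) : Prop :=
  x 0 = xin ∧ ∀ t ∈ Set.Icc 0 T,
    HasDerivWithinAt x (F₁.mulVec (x t) + F₂.mulVec (tensorSq (x t))) (Set.Icc 0 T) t

/-- The blocks `y 1, …, y N` solve the level-`N` truncated Carleman system on `[0, T]`, that is
`y_j' = A_{j,j} y_j + A_{j,j+1} y_{j+1}` for `1 ≤ j < N` and `y_N' = A_{N,N} y_N`, with
`y_j(0) = xin^{⊗ j}`. The values of `y j` for `j = 0` and `j > N` play no role. -/
def IsCarlemanSolution {n : ℕ} (F₁ : Matrix (Fin n) (Fin n) ℝ)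
    (F₂ : Matrix (Fin n) (Fin n × Fin n) ℝ) (xin : Fin n → ℝ) (N : ℕ) (T : ℝ)
    (y : (j : ℕ) → ℝ → (Fin j → Fin n) → ℝ) : Prop :=
  ∀ j, 1 ≤ j → j ≤ N → y j 0 = tensorPow xin j ∧ ∀ t ∈ Set.Icc 0 T,
    HasDerivWithinAt (y j)
      ((diagBlock F₁ j).mulVec (y j t) +
        if j < N then (superBlock F₂ j).mulVec (y (j + 1) t) else 0)
      (Set.Icc 0 T) t

/-- The first block `y_1(t)`, read as a vector indexed by `Fin n`. -/
def firstBlock {n : ℕ} (y : (j : ℕ) → ℝ → (Fin j → Fin n) → ℝ) (t : ℝ) : Fin n → ℝ :=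
  fun i => y 1 t (fun _ => i)

/-- The constant `C = κ₁(W) ‖F₂‖₁ μ²`. -/
def errConst {n : ℕ} (W : Matrix (Fin n) (Fin n) ℂ)
    (F₂ : Matrix (Fin n) (Fin n × Fin n) ℝ) (μ : ℝ) : ℝ :=
  condNum1 W * matNorm1 F₂ * μ ^ 2

/-- The rate `R_r = 4 e μ κ₁(W) ‖F₂‖₁ / Δ`. -/
def resRate {n : ℕ} (W : Matrix (Fin n) (Fin n) ℂ) (lam : Fin n → ℂ)
    (F₂ : Matrix (Fin n) (Fin n × Fin n) ℝ) (μ : ℝ) : ℝ :=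
  4 * Real.exp 1 * μ * condNum1 W * matNorm1 F₂ / resonanceParam lam

end

end Carleman

/-!
Conjugate eigenvalues of the real matrix `F₁` give the resonance
`λ_k - (2 λ_k + conj λ_k) = -2 Re λ_k`, so `Re λ_k ≤ -Δ / 2` and `e^{tF₁}` decays at rate `Δ / 2`.

Expand the solution with initial value `ε xin` as `∑ m, ε ^ m u_m`. The tensor powers of this
series solve the infinite Carleman system, and discarding the degrees above `N` solves exactly the
truncated one, because the `j`-th tensor power starts in degree `j`. Hence `y_1` is the Taylor
polynomial `u_1 + ⋯ + u_N`, and the error is the remainder of the expansion at `ε = 1`. No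
convergence is needed: the remainder solves a linear equation whose forcing is a convolution of
terms and earlier remainders, each product containing a single remainder. Bounding these equations
by Duhamel's formula gives the recursion of the Catalan numbers, which are at most powers of `4`.

The first term satisfies `‖u_1‖ ≤ κ₁(W) μ`, which gives the unrestricted estimate. Alternatively
`x - u_1` solves a linear equation with forcing `F₂ (x ⊗ x)`, which bounds `‖u_1‖` without the
factor `κ₁(W)`, up to a relative error of `2 κ₁(W) ‖F₂‖₁ μ / Δ`; this gives the estimate for
`R_r ≤ 1`.
-/

namespace Carleman

open Matrix Set
open Finset.HasAntidiagonal (antidiagonal mem_antidiagonal)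

section Norms

variable {𝕜 ι κ τ : Type*} [RCLike 𝕜] [Fintype ι] [Fintype κ] [Fintype τ]

theorem vecNorm1_nonneg (v : ι → 𝕜) : 0 ≤ vecNorm1 v :=
  Finset.sum_nonneg fun _ _ => norm_nonneg _

theorem vecNorm1_zero : vecNorm1 (0 : ι → 𝕜) = 0 := by simp [vecNorm1]

theorem norm_toLp_eq_vecNorm1 (v : ι → 𝕜) : ‖WithLp.toLp 1 v‖ = vecNorm1 v :=
  PiLp.norm_eq_of_L1 _

theorem vecNorm1_add_le (v w : ι → 𝕜) : vecNorm1 (v + w) ≤ vecNorm1 v + vecNorm1 w := by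
  simp only [← norm_toLp_eq_vecNorm1, WithLp.toLp_add]
  exact norm_add_le _ _

theorem vecNorm1_sub_le (v w : ι → 𝕜) : vecNorm1 (v - w) ≤ vecNorm1 v + vecNorm1 w := by
  simp only [← norm_toLp_eq_vecNorm1, WithLp.toLp_sub]
  exact norm_sub_le _ _

theorem vecNorm1_sum_le {α : Type*} (s : Finset α) (f : α → ι → 𝕜) :
    vecNorm1 (∑ a ∈ s, f a) ≤ ∑ a ∈ s, vecNorm1 (f a) :=
  Finset.le_sum_of_subadditive _ vecNorm1_zero.le vecNorm1_add_le s f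

theorem vecNorm1_ofReal (v : ι → ℝ) : vecNorm1 (fun i => (v i : ℂ)) = vecNorm1 v := by
  simp [vecNorm1]

theorem bddBelow_matNorm1_bounds (A : Matrix ι κ 𝕜) :
    BddBelow {c : ℝ | 0 ≤ c ∧ ∀ v : κ → 𝕜, vecNorm1 (A *ᵥ v) ≤ c * vecNorm1 v} :=
  ⟨0, fun _ hc => hc.1⟩

theorem matNorm1_bounds_nonempty (A : Matrix ι κ 𝕜) :
    {c : ℝ | 0 ≤ c ∧ ∀ v : κ → 𝕜, vecNorm1 (A *ᵥ v) ≤ c * vecNorm1 v}.Nonempty := by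
  refine ⟨∑ i, ∑ j, ‖A i j‖, by positivity, fun v => ?_⟩
  rw [Finset.sum_mul]
  refine Finset.sum_le_sum fun i _ => ?_
  rw [Finset.sum_mul]
  refine norm_sum_le_of_le _ fun j hj => ?_
  rw [norm_mul]
  gcongr
  exact Finset.single_le_sum (f := fun j => ‖v j‖) (fun _ _ => norm_nonneg _) hj

theorem matNorm1_nonneg (A : Matrix ι κ 𝕜) : 0 ≤ matNorm1 A :=
  Real.sInf_nonneg fun _ hc => hc.1

theorem matNorm1_le {A : Matrix ι κ 𝕜} {c : ℝ} (hc : 0 ≤ c)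
    (h : ∀ v, vecNorm1 (A *ᵥ v) ≤ c * vecNorm1 v) : matNorm1 A ≤ c :=
  csInf_le (bddBelow_matNorm1_bounds A) ⟨hc, h⟩

theorem vecNorm1_mulVec_le (A : Matrix ι κ 𝕜) (v : κ → 𝕜) :
    vecNorm1 (A *ᵥ v) ≤ matNorm1 A * vecNorm1 v := by
  rcases (vecNorm1_nonneg v).eq_or_lt with h | h
  · obtain ⟨c, -, hc⟩ := matNorm1_bounds_nonempty A
    simpa only [← h, mul_zero] using hc v
  · rw [← div_le_iff₀ h]
    exact le_csInf (matNorm1_bounds_nonempty A) fun c hc => (div_le_iff₀ h).2 (hc.2 v)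

theorem vecNorm1_mulVec_le_of_le (A : Matrix ι κ 𝕜) {v : κ → 𝕜} {c : ℝ} (h : vecNorm1 v ≤ c) :
    vecNorm1 (A *ᵥ v) ≤ matNorm1 A * c :=
  (vecNorm1_mulVec_le A v).trans (mul_le_mul_of_nonneg_left h (matNorm1_nonneg A))

theorem matNorm1_mul_le (A : Matrix ι κ 𝕜) (B : Matrix κ τ 𝕜) :
    matNorm1 (A * B) ≤ matNorm1 A * matNorm1 B := by
  refine matNorm1_le (mul_nonneg (matNorm1_nonneg A) (matNorm1_nonneg B)) fun v => ?_
  rw [← mulVec_mulVec, mul_assoc]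
  exact vecNorm1_mulVec_le_of_le A (vecNorm1_mulVec_le B v)

theorem matNorm1_diagonal_le [DecidableEq ι] {d : ι → 𝕜} {c : ℝ} (hc : 0 ≤ c)
    (h : ∀ i, ‖d i‖ ≤ c) : matNorm1 (diagonal d) ≤ c := by
  refine matNorm1_le hc fun v => ?_
  simp only [vecNorm1, mulVec_diagonal, norm_mul, Finset.mul_sum]
  gcongr with i
  exact h i

theorem matNorm1_le_matNorm1_map_ofReal (A : Matrix ι κ ℝ) :
    matNorm1 A ≤ matNorm1 (A.map Complex.ofRealHom) := by
  refine matNorm1_le (matNorm1_nonneg _) fun v => ?_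
  have hmap : (fun i => ((A *ᵥ v) i : ℂ)) = A.map Complex.ofRealHom *ᵥ fun i => (v i : ℂ) :=
    funext (Complex.ofRealHom.map_mulVec A v)
  rw [← vecNorm1_ofReal, hmap, ← vecNorm1_ofReal v]
  exact vecNorm1_mulVec_le _ _

theorem vecNorm1_le_of_vecNorm1_deriv_le {f f' : ℝ → ι → ℝ} {B B' : ℝ → ℝ} {a b : ℝ}
    (hf : ∀ t ∈ Icc a b, HasDerivWithinAt f (f' t) (Icc a b) t) (ha : vecNorm1 (f a) ≤ B a)
    (hB : ∀ t, HasDerivAt B (B' t) t) (hle : ∀ t ∈ Icc a b, vecNorm1 (f' t) ≤ B' t)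
    {t : ℝ} (ht : t ∈ Icc a b) : vecNorm1 (f t) ≤ B t := by
  have hf₁ : ∀ t ∈ Icc a b, HasDerivWithinAt (fun t => WithLp.toLp 1 (f t))
      (WithLp.toLp 1 (f' t)) (Icc a b) t := fun t ht =>
    (PiLp.hasFDerivAt_toLp (𝕜 := ℝ) 1 (f t)).comp_hasDerivWithinAt t (hf t ht)
  simp only [← norm_toLp_eq_vecNorm1] at ha hle ⊢
  exact image_norm_le_of_norm_deriv_right_le_deriv_boundary
    (fun t ht => (hf₁ t ht).continuousWithinAt)
    (fun t ht => (hf₁ t (Ico_subset_Icc_self ht)).mono_of_mem_nhdsWithin (Icc_mem_nhdsGE_of_mem ht))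
    ha hB (fun t ht => hle t (Ico_subset_Icc_self ht)) ht

end Norms

section LinearODE

open scoped Matrix.Norms.Operator

variable {ι : Type*} [Fintype ι]

theorem hasDerivWithinAt_mulVec {M : ℝ → Matrix ι ι ℝ} {M' : Matrix ι ι ℝ} {v : ℝ → ι → ℝ}
    {v' : ι → ℝ} {s : Set ℝ} {t : ℝ} (hM : HasDerivWithinAt M M' s t)
    (hv : HasDerivWithinAt v v' s t) :
    HasDerivWithinAt (fun r => M r *ᵥ v r) (M' *ᵥ v t + M t *ᵥ v') s t := by
  refine hasDerivWithinAt_pi.2 fun i => ?_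
  simp only [Pi.add_apply, mulVec, dotProduct, ← Finset.sum_add_distrib]
  exact HasDerivWithinAt.fun_sum fun j _ =>
    (hasDerivWithinAt_pi.1 (hasDerivWithinAt_pi.1 hM i) j).fun_mul (hasDerivWithinAt_pi.1 hv j)

theorem eqOn_of_hasDerivWithinAt_mulVec_add {F : Matrix ι ι ℝ} {v w g : ℝ → ι → ℝ} {T : ℝ}
    (hv : ∀ t ∈ Icc 0 T, HasDerivWithinAt v (F *ᵥ v t + g t) (Icc 0 T) t)
    (hw : ∀ t ∈ Icc 0 T, HasDerivWithinAt w (F *ᵥ w t + g t) (Icc 0 T) t) (h₀ : v 0 = w 0) :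
    EqOn v w (Icc 0 T) := by
  let L : (ι → ℝ) →L[ℝ] (ι → ℝ) := LinearMap.toContinuousLinearMap F.mulVecLin
  have hright : ∀ {z : ℝ → ι → ℝ},
      (∀ t ∈ Icc 0 T, HasDerivWithinAt z (F *ᵥ z t + g t) (Icc 0 T) t) →
      ∀ t ∈ Ico 0 T, HasDerivWithinAt z (L (z t) + g t) (Ici t) t := fun hz t ht =>
    (hz t (Ico_subset_Icc_self ht)).mono_of_mem_nhdsWithin (Icc_mem_nhdsGE_of_mem ht)
  exact ODE_solution_unique_of_mem_Icc_right (v := fun t z => L z + g t) (s := fun _ => univ)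
    (fun t _ => (L.lipschitz.add (.const (g t))).lipschitzOnWith)
    (fun t ht => (hv t ht).continuousWithinAt) (hright hv) (fun _ _ => mem_univ _)
    (fun t ht => (hw t ht).continuousWithinAt) (hright hw) (fun _ _ => mem_univ _) h₀

variable [DecidableEq ι]

theorem hasDerivAt_exp_smul (F : Matrix ι ι ℝ) (t : ℝ) :
    HasDerivAt (fun s : ℝ => NormedSpace.exp (s • F)) (F * NormedSpace.exp (t • F)) t :=
  hasDerivAt_exp_smul_const' F t

theorem commute_exp_smul (F : Matrix ι ι ℝ) (t : ℝ) : Commute F (NormedSpace.exp (t • F)) :=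
  ((Commute.refl F).smul_right t).exp_right

theorem continuous_exp_smul (F : Matrix ι ι ℝ) :
    Continuous fun s : ℝ => NormedSpace.exp (s • F) :=
  continuous_iff_continuousAt.2 fun t => (hasDerivAt_exp_smul F t).continuousAt

theorem exp_smul_mul_exp_neg_smul (F : Matrix ι ι ℝ) (t : ℝ) :
    NormedSpace.exp (t • F) * NormedSpace.exp (-t • F) = 1 := by
  rw [← Matrix.exp_add_of_commute _ _ (((Commute.refl F).smul_left t).smul_right (-t)), ← add_smul,
    add_neg_cancel, zero_smul, NormedSpace.exp_zero]

/-- The solution of `v' = F v + g`, `v 0 = v₀`, by Duhamel's formula. -/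
noncomputable def linearFlow (F : Matrix ι ι ℝ) (g : ℝ → ι → ℝ) (v₀ : ι → ℝ) (t : ℝ) : ι → ℝ :=
  NormedSpace.exp (t • F) *ᵥ (v₀ + ∫ s in (0 : ℝ)..t, NormedSpace.exp (-s • F) *ᵥ g s)

theorem linearFlow_zero (F : Matrix ι ι ℝ) (g : ℝ → ι → ℝ) (v₀ : ι → ℝ) :
    linearFlow F g v₀ 0 = v₀ := by
  simp [linearFlow]

theorem hasDerivAt_linearFlow (F : Matrix ι ι ℝ) {g : ℝ → ι → ℝ} (hg : Continuous g)
    (v₀ : ι → ℝ) (t : ℝ) :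
    HasDerivAt (linearFlow F g v₀) (F *ᵥ linearFlow F g v₀ t + g t) t := by
  have hcont : Continuous fun s : ℝ => NormedSpace.exp (-s • F) *ᵥ g s :=
    ((continuous_exp_smul F).comp continuous_neg).matrix_mulVec hg
  have hint := (hcont.integral_hasStrictDerivAt 0 t).hasDerivAt.const_add v₀
  have h := hasDerivWithinAt_mulVec (hasDerivAt_exp_smul F t).hasDerivWithinAt
    (s := univ) hint.hasDerivWithinAt
  rw [hasDerivWithinAt_univ] at h
  refine h.congr_deriv ?_
  rw [linearFlow, mulVec_mulVec, mulVec_mulVec, exp_smul_mul_exp_neg_smul, one_mulVec]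

theorem continuous_linearFlow (F : Matrix ι ι ℝ) {g : ℝ → ι → ℝ} (hg : Continuous g)
    (v₀ : ι → ℝ) : Continuous (linearFlow F g v₀) :=
  continuous_iff_continuousAt.2 fun t => (hasDerivAt_linearFlow F hg v₀ t).continuousAt

variable {F : Matrix ι ι ℝ} {v g : ℝ → ι → ℝ} {T t : ℝ}

theorem hasDerivWithinAt_exp_sub_smul_mulVec {s : Set ℝ}
    (hv : HasDerivWithinAt v (F *ᵥ v t + g t) s t) (r : ℝ) :
    HasDerivWithinAt (fun t => NormedSpace.exp ((r - t) • F) *ᵥ v t)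
      (NormedSpace.exp ((r - t) • F) *ᵥ g t) s t := by
  have hexp : HasDerivAt (fun t => NormedSpace.exp ((r - t) • F))
      ((-1 : ℝ) • (F * NormedSpace.exp ((r - t) • F))) t :=
    (hasDerivAt_exp_smul F (r - t)).scomp t ((hasDerivAt_id t).const_sub r)
  refine (hasDerivWithinAt_mulVec hexp.hasDerivWithinAt hv).congr_deriv ?_
  rw [(commute_exp_smul F _).eq, mulVec_add, mulVec_mulVec, neg_one_smul, neg_mulVec,
    neg_add_cancel_left]

/-- Exponential stability of the semigroup generated by `F`, in the norm induced by `ℓ¹`. -/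
def IsExpStable (F : Matrix ι ι ℝ) (K γ : ℝ) : Prop :=
  ∀ t, 0 ≤ t → matNorm1 (NormedSpace.exp (t • F)) ≤ K * Real.exp (-(γ * t))

namespace IsExpStable

variable {K γ G : ℝ}

theorem const_nonneg (hF : IsExpStable F K γ) : 0 ≤ K := by
  simpa using (matNorm1_nonneg _).trans (hF 0 le_rfl)

theorem vecNorm1_exp_mulVec_le (hF : IsExpStable F K γ) (ht : 0 ≤ t) (z : ι → ℝ) :
    vecNorm1 (NormedSpace.exp (t • F) *ᵥ z) ≤ K * Real.exp (-(γ * t)) * vecNorm1 z :=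
  (vecNorm1_mulVec_le _ z).trans (mul_le_mul_of_nonneg_right (hF t ht) (vecNorm1_nonneg z))

theorem vecNorm1_le_const_mul (hF : IsExpStable F K γ) (z : ι → ℝ) :
    vecNorm1 z ≤ K * vecNorm1 z := by
  simpa using hF.vecNorm1_exp_mulVec_le le_rfl z

theorem vecNorm1_solution_le (hF : IsExpStable F K γ) (hγ : γ ≠ 0)
    (hv : ∀ t ∈ Icc 0 T, HasDerivWithinAt v (F *ᵥ v t + g t) (Icc 0 T) t)
    (hg : ∀ t ∈ Icc 0 T, vecNorm1 (g t) ≤ G) (ht : t ∈ Icc 0 T) :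
    vecNorm1 (v t) ≤ K * (Real.exp (-(γ * t)) * vecNorm1 (v 0) +
      G * ((1 - Real.exp (-(γ * t))) / γ)) := by
  have hsub : Icc 0 t ⊆ Icc 0 T := Icc_subset_Icc_right ht.2
  let B : ℝ → ℝ := fun s => K * (Real.exp (-(γ * t)) * vecNorm1 (v 0) +
    G * ((Real.exp (-(γ * (t - s))) - Real.exp (-(γ * t))) / γ))
  have hB : ∀ s, HasDerivAt B (K * (G * Real.exp (-(γ * (t - s))))) s := fun s => by
    have hlin : HasDerivAt (fun s => -(γ * (t - s))) γ s := by
      simpa using (((hasDerivAt_id s).const_sub t).const_mul γ).fun_neg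
    have h := ((((hlin.exp.sub_const (Real.exp (-(γ * t)))).div_const γ).const_mul G).const_add
      (Real.exp (-(γ * t)) * vecNorm1 (v 0))).const_mul K
    rwa [mul_div_cancel_right₀ _ hγ] at h
  have hB₀ : vecNorm1 (NormedSpace.exp ((t - 0) • F) *ᵥ v 0) ≤ B 0 := by
    simpa [B, mul_assoc] using hF.vecNorm1_exp_mulVec_le ht.1 (v 0)
  have hB' : ∀ s ∈ Icc 0 t, vecNorm1 (NormedSpace.exp ((t - s) • F) *ᵥ g s) ≤
      K * (G * Real.exp (-(γ * (t - s)))) := fun s hs =>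
    calc _ ≤ K * Real.exp (-(γ * (t - s))) * vecNorm1 (g s) :=
          hF.vecNorm1_exp_mulVec_le (sub_nonneg.2 hs.2) _
      _ ≤ K * Real.exp (-(γ * (t - s))) * G :=
          mul_le_mul_of_nonneg_left (hg s (hsub hs))
            (mul_nonneg hF.const_nonneg (Real.exp_pos _).le)
      _ = _ := by ring
  simpa [B] using vecNorm1_le_of_vecNorm1_deriv_le
    (fun s hs => (hasDerivWithinAt_exp_sub_smul_mulVec (hv s (hsub hs)) t).mono hsub)
    hB₀ hB hB' (right_mem_Icc.2 ht.1)

theorem vecNorm1_solution_le_div (hF : IsExpStable F K γ) (hγ : 0 < γ)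
    (hv : ∀ t ∈ Icc 0 T, HasDerivWithinAt v (F *ᵥ v t + g t) (Icc 0 T) t)
    (hg : ∀ t ∈ Icc 0 T, vecNorm1 (g t) ≤ G) (hv₀ : v 0 = 0) (ht : t ∈ Icc 0 T) :
    vecNorm1 (v t) ≤ K * G / γ := by
  have hK := hF.const_nonneg
  have hG : 0 ≤ G := (vecNorm1_nonneg _).trans (hg t ht)
  calc vecNorm1 (v t) ≤ K * (G * ((1 - Real.exp (-(γ * t))) / γ)) := by
        simpa [hv₀, vecNorm1_zero] using hF.vecNorm1_solution_le hγ.ne' hv hg ht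
    _ ≤ K * (G * (1 / γ)) := by
        gcongr
        exact sub_le_self _ (Real.exp_pos _).le
    _ = K * G / γ := by ring

theorem vecNorm1_solution_le_mul (hF : IsExpStable F K γ) (hγ : 0 < γ)
    (hv : ∀ t ∈ Icc 0 T, HasDerivWithinAt v (F *ᵥ v t + g t) (Icc 0 T) t)
    (hg : ∀ t ∈ Icc 0 T, vecNorm1 (g t) ≤ G) (hv₀ : v 0 = 0) (ht : t ∈ Icc 0 T) :
    vecNorm1 (v t) ≤ K * G * T := by
  have hK := hF.const_nonneg
  have hG : 0 ≤ G := (vecNorm1_nonneg _).trans (hg t ht)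
  have hexp : (1 - Real.exp (-(γ * t))) / γ ≤ t := by
    rw [div_le_iff₀ hγ]
    linarith [Real.add_one_le_exp (-(γ * t))]
  calc vecNorm1 (v t) ≤ K * (G * ((1 - Real.exp (-(γ * t))) / γ)) := by
        simpa [hv₀, vecNorm1_zero] using hF.vecNorm1_solution_le hγ.ne' hv hg ht
    _ ≤ K * (G * T) := by
        gcongr
        exact hexp.trans ht.2
    _ = K * G * T := by ring

end IsExpStable

end LinearODE

section Diagonalization

variable {n : ℕ} {F : Matrix (Fin n) (Fin n) ℝ} {W : Matrix (Fin n) (Fin n) ℂ}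
  {lam : Fin n → ℂ}

open scoped Matrix.Norms.Operator in
theorem map_ofReal_exp (F : Matrix (Fin n) (Fin n) ℝ) :
    (NormedSpace.exp F).map Complex.ofRealHom = NormedSpace.exp (F.map Complex.ofRealHom) :=
  NormedSpace.map_exp Complex.ofRealHom.mapMatrix
    (continuous_id.matrix_map Complex.continuous_ofReal) F

theorem map_ofReal_exp_smul (hW : IsUnit W.det)
    (hF : F.map (fun r : ℝ => (r : ℂ)) = W * diagonal lam * W⁻¹) (t : ℝ) :
    (NormedSpace.exp (t • F)).map Complex.ofRealHom =
      W * diagonal (fun k => Complex.exp (t * lam k)) * W⁻¹ := by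
  have hsmul : (t • F).map Complex.ofRealHom = W * diagonal ((t : ℂ) • lam) * W⁻¹ := by
    rw [diagonal_smul, Matrix.mul_smul, Matrix.smul_mul, ← hF]
    ext
    simp
  rw [map_ofReal_exp, hsmul, Matrix.exp_conj _ _ ((isUnit_iff_isUnit_det W).2 hW),
    Matrix.exp_diagonal]
  congr
  ext k
  simp [Pi.coe_exp, Complex.exp_eq_exp_ℂ]

theorem isExpStable_of_eq_conj_diagonal (hW : IsUnit W.det)
    (hF : F.map (fun r : ℝ => (r : ℂ)) = W * diagonal lam * W⁻¹) {γ : ℝ}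
    (hγ : ∀ k, (lam k).re ≤ -γ) : IsExpStable F (condNum1 W) γ := fun t ht => by
  have hdiag : matNorm1 (diagonal fun k => Complex.exp (t * lam k)) ≤ Real.exp (-(γ * t)) :=
    matNorm1_diagonal_le (Real.exp_pos _).le fun k => by
      rw [Complex.norm_exp, Complex.re_ofReal_mul, Real.exp_le_exp]
      nlinarith [hγ k]
  calc matNorm1 (NormedSpace.exp (t • F))
      ≤ matNorm1 (W * diagonal (fun k => Complex.exp (t * lam k)) * W⁻¹) :=
        map_ofReal_exp_smul hW hF t ▸ matNorm1_le_matNorm1_map_ofReal _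
    _ ≤ matNorm1 W * Real.exp (-(γ * t)) * matNorm1 W⁻¹ :=
        (matNorm1_mul_le _ _).trans (mul_le_mul_of_nonneg_right
          ((matNorm1_mul_le _ _).trans (mul_le_mul_of_nonneg_left hdiag (matNorm1_nonneg W)))
          (matNorm1_nonneg _))
    _ = condNum1 W * Real.exp (-(γ * t)) := by rw [condNum1]; ring

theorem spectrum_conj_diagonal (hW : IsUnit W.det) (lam : Fin n → ℂ) :
    spectrum ℂ (W * diagonal lam * W⁻¹) = range lam := by
  obtain ⟨U, rfl⟩ := (isUnit_iff_isUnit_det W).2 hW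
  rw [← coe_units_inv, spectrum.units_conjugate, spectrum_diagonal]

theorem mem_spectrum_map_ofReal_iff (F : Matrix (Fin n) (Fin n) ℝ) (z : ℂ) :
    z ∈ spectrum ℂ (F.map Complex.ofRealHom) ↔ F.charpoly.aeval z = 0 := by
  rw [mem_spectrum_iff_isRoot_charpoly, charpoly_map, Polynomial.IsRoot, Polynomial.eval_map,
    Polynomial.aeval_def]
  rfl

theorem exists_eigenvalue_eq_conj (hW : IsUnit W.det)
    (hF : F.map (fun r : ℝ => (r : ℂ)) = W * diagonal lam * W⁻¹) (k : Fin n) :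
    ∃ j, lam j = (starRingEnd ℂ) (lam k) := by
  have hspec (z : ℂ) : z ∈ range lam ↔ F.charpoly.aeval z = 0 := by
    rw [← spectrum_conj_diagonal hW lam, ← hF]
    exact mem_spectrum_map_ofReal_iff F z
  exact (hspec _).2 (by rw [Polynomial.aeval_conj, (hspec _).1 (mem_range_self k), map_zero])

theorem resonanceParam_le (lam : Fin n → ℂ) (k : Fin n) (m : Fin n → ℕ) (hm : 2 ≤ ∑ j, m j) :
    resonanceParam lam ≤ ‖lam k - ∑ j, (m j : ℂ) * lam j‖ :=
  csInf_le ⟨0, by rintro _ ⟨_, _, _, rfl⟩; exact norm_nonneg _⟩ ⟨k, m, hm, rfl⟩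

/-- The conjugate of `λ_k` is again an eigenvalue of the real matrix `F`, and the resonance
`λ_k - (2 λ_k + conj λ_k) = -2 Re λ_k` bounds the resonance parameter. -/
theorem re_eigenvalue_le_neg_half_resonanceParam (hW : IsUnit W.det)
    (hF : F.map (fun r : ℝ => (r : ℂ)) = W * diagonal lam * W⁻¹)
    (hre : ∀ k, (lam k).re ≤ 0) (k : Fin n) :
    (lam k).re ≤ -(resonanceParam lam / 2) := by
  obtain ⟨j, hj⟩ := exists_eigenvalue_eq_conj hW hF k
  have hle := resonanceParam_le lam k (Pi.single k 2 + Pi.single j 1)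
    (by simp [Finset.sum_add_distrib])
  have hsum : ∑ i, ((Pi.single k 2 + Pi.single j 1 : Fin n → ℕ) i : ℂ) * lam i =
      2 * lam k + (starRingEnd ℂ) (lam k) := by
    simp [Pi.single_apply, add_mul, Finset.sum_add_distrib, hj]
  have hres : lam k - (2 * lam k + (starRingEnd ℂ) (lam k)) = ((-(2 * (lam k).re) : ℝ) : ℂ) := by
    rw [Complex.ofReal_neg, ← Complex.add_conj]
    ring
  rw [hsum, hres, Complex.norm_real, Real.norm_of_nonneg (by linarith [hre k])] at hle
  linarith

end Diagonalization

section Blocks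

theorem sum_prod_one_apply_smul {α κ M : Type*} [Fintype α] [DecidableEq α] [Fintype κ]
    [DecidableEq κ] [AddCommMonoid M] [Module ℝ M] (a : κ → α) (i : κ) (G : (κ → α) → M) :
    ∑ b, (∏ k, if k = i then 1 else (1 : Matrix α α ℝ) (a k) (b k)) • G b =
      ∑ c, G (Function.update a i c) := by
  refine (Fintype.sum_of_injective (Function.update a i) (Function.update_injective a i) _ _
    (fun b hb => ?_) fun c => ?_).symm
  · obtain ⟨k, hki, hk⟩ : ∃ k, k ≠ i ∧ a k ≠ b k := by
      by_contra! h
      exact hb ⟨b i, Function.update_eq_iff.2 ⟨rfl, h⟩⟩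
    rw [Finset.prod_eq_zero (Finset.mem_univ k) (by simp [hki, hk]), zero_smul]
  · rw [Finset.prod_eq_one, one_smul]
    intro k _
    split_ifs with hk
    · rfl
    · rw [Function.update_of_ne hk, one_apply_eq]

variable {n j : ℕ}

theorem removeNth_succ_of_le {i k : Fin j} (b : Fin (j + 1) → Fin n) (hk : k ≤ i) :
    i.succ.removeNth b k = b k.castSucc := by
  rw [Fin.removeNth_apply, Fin.succAbove_of_castSucc_lt _ _ (Fin.castSucc_lt_succ_iff.2 hk)]

theorem removeNth_succ_of_lt {i k : Fin j} (b : Fin (j + 1) → Fin n) (hk : i < k) :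
    i.succ.removeNth b k = b k.succ := by
  rw [Fin.removeNth_apply, Fin.succAbove_of_lt_succ _ _ (Fin.succ_lt_succ_iff.2 hk)]

theorem prod_superBlock_eq_prod_removeNth (i : Fin j) (a : Fin j → Fin n)
    (b : Fin (j + 1) → Fin n) :
    (∏ k : Fin j,
      if k < i then (1 : Matrix (Fin n) (Fin n) ℝ) (a k) (b k.castSucc)
      else if i < k then (1 : Matrix (Fin n) (Fin n) ℝ) (a k) (b k.succ)
      else 1) =
      ∏ k, if k = i then 1 else (1 : Matrix (Fin n) (Fin n) ℝ) (a k) (i.succ.removeNth b k) := by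
  refine Finset.prod_congr rfl fun k _ => ?_
  rcases lt_trichotomy k i with hk | rfl | hk
  · rw [if_pos hk, if_neg hk.ne, removeNth_succ_of_le b hk.le]
  · simp
  · rw [if_neg hk.asymm, if_pos hk, if_neg hk.ne', removeNth_succ_of_lt b hk]

variable {R : Type*} [CommRing R]

theorem prod_comp_update (U : Fin n → R) (a : Fin j → Fin n) (i : Fin j) (c : Fin n) :
    ∏ k, U (Function.update a i c k) = U c * ∏ k ∈ Finset.univ.erase i, U (a k) := by
  rw [← Finset.mul_prod_erase _ _ (Finset.mem_univ i), Function.update_self]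
  exact congrArg _ <| Finset.prod_congr rfl fun k hk => by
    rw [Function.update_of_ne (Finset.ne_of_mem_erase hk)]

variable [Algebra ℝ R]

theorem sum_diagBlock_smul_prod (F₁ : Matrix (Fin n) (Fin n) ℝ) (U : Fin n → R)
    (a : Fin j → Fin n) :
    ∑ b, diagBlock F₁ j a b • ∏ k, U (b k) =
      ∑ i, (∑ c, F₁ (a i) c • U c) * ∏ k ∈ Finset.univ.erase i, U (a k) := by
  simp only [diagBlock, Finset.sum_smul]
  rw [Finset.sum_comm]
  refine Finset.sum_congr rfl fun i _ => ?_
  simp only [mul_comm (F₁ _ _), mul_smul]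
  rw [sum_prod_one_apply_smul a i fun b => F₁ (a i) (b i) • ∏ k, U (b k), Finset.sum_mul]
  simp only [Function.update_self, prod_comp_update, smul_mul_assoc]

theorem sum_superBlock_smul_prod (F₂ : Matrix (Fin n) (Fin n × Fin n) ℝ) (U : Fin n → R)
    (a : Fin j → Fin n) :
    ∑ b, superBlock F₂ j a b • ∏ k, U (b k) =
      ∑ i, (∑ p : Fin n × Fin n, F₂ (a i) p • (U p.1 * U p.2)) *
        ∏ k ∈ Finset.univ.erase i, U (a k) := by
  simp only [superBlock, Finset.sum_smul]
  rw [Finset.sum_comm]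
  refine Finset.sum_congr rfl fun i _ => ?_
  -- The index `b` is split into its entry at position `i + 1` and its remaining `j` entries.
  let G (d : Fin n) (b : Fin j → Fin n) : R := F₂ (a i) (b i, d) • (U d * ∏ k, U (b k))
  let H (q : Fin n × (Fin j → Fin n)) : R :=
    (∏ k, if k = i then 1 else (1 : Matrix (Fin n) (Fin n) ℝ) (a k) (q.2 k)) • G q.1 q.2
  have hsplit (b : Fin (j + 1) → Fin n) : ∏ k, U (b k) =
      U (b i.succ) * ∏ k, U (i.succ.removeNth b k) :=
    Fin.prod_univ_succAbove _ i.succ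
  have hupdate (c d : Fin n) : G d (Function.update a i c) =
      F₂ (a i) (c, d) • (U c * U d) * ∏ k ∈ Finset.univ.erase i, U (a k) := by
    simp only [G, Function.update_self, prod_comp_update, smul_mul_assoc]
    rw [mul_left_comm, mul_assoc]
  calc _ = ∑ b, H ((Fin.insertNthEquiv (fun _ => Fin n) i.succ).symm b) := by
        refine Finset.sum_congr rfl fun b _ => ?_
        rw [prod_superBlock_eq_prod_removeNth, mul_comm, mul_smul, hsplit,
          ← removeNth_succ_of_le b le_rfl]
        rfl
    _ = ∑ d, ∑ c, G d (Function.update a i c) := by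
        rw [Equiv.sum_comp, Fintype.sum_prod_type]
        exact Finset.sum_congr rfl fun d _ => sum_prod_one_apply_smul a i (G d)
    _ = _ := by
        rw [Finset.sum_comm, Fintype.sum_prod_type, Finset.sum_mul]
        refine Finset.sum_congr rfl fun c _ => ?_
        rw [Finset.sum_mul]
        exact Finset.sum_congr rfl fun d _ => hupdate c d

end Blocks

section CoeffDeriv

open PowerSeries

/-- The curve `f` of formal power series is differentiable at `t` coefficient by coefficient, with
derivative `f'`. -/
def HasCoeffDerivAt (f : ℝ → ℝ⟦X⟧) (f' : ℝ⟦X⟧) (t : ℝ) : Prop :=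
  ∀ m, HasDerivAt (fun s => coeff m (f s)) (coeff m f') t

namespace HasCoeffDerivAt

variable {f g : ℝ → ℝ⟦X⟧} {f' g' : ℝ⟦X⟧} {t : ℝ}

theorem mul (hf : HasCoeffDerivAt f f' t) (hg : HasCoeffDerivAt g g' t) :
    HasCoeffDerivAt (fun s => f s * g s) (f' * g t + f t * g') t := fun m => by
  simp only [coeff_mul, map_add, ← Finset.sum_add_distrib]
  exact HasDerivAt.fun_sum fun p _ => (hf p.1).fun_mul (hg p.2)

theorem finset_prod {κ : Type*} [DecidableEq κ] {f : κ → ℝ → ℝ⟦X⟧} {f' : κ → ℝ⟦X⟧}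
    {s : Finset κ} (hf : ∀ i ∈ s, HasCoeffDerivAt (f i) (f' i) t) :
    HasCoeffDerivAt (fun r => ∏ i ∈ s, f i r) (∑ i ∈ s, f' i * ∏ k ∈ s.erase i, f k t) t := by
  induction s using Finset.induction_on with
  | empty => exact fun m => by simpa using hasDerivAt_const t (coeff m (1 : ℝ⟦X⟧))
  | insert a s ha ih =>
    have hs : ∑ i ∈ s, f' i * ∏ k ∈ (insert a s).erase i, f k t =
        f a t * ∑ i ∈ s, f' i * ∏ k ∈ s.erase i, f k t := by
      rw [Finset.mul_sum]
      refine Finset.sum_congr rfl fun i hi => ?_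
      rw [Finset.erase_insert_of_ne (ne_of_mem_of_not_mem hi ha).symm,
        Finset.prod_insert fun h => ha (Finset.mem_of_mem_erase h), mul_left_comm]
    simp only [Finset.prod_insert ha, Finset.sum_insert ha, Finset.erase_insert ha, hs]
    exact (hf a (Finset.mem_insert_self a s)).mul
      (ih fun i hi => hf i (Finset.mem_insert_of_mem hi))

end HasCoeffDerivAt

/-- The sum of the coefficients of degree at most `N`, that is, the value at `X = 1` of the
truncation. -/
noncomputable def coeffSum (N : ℕ) : ℝ⟦X⟧ →ₗ[ℝ] ℝ :=
  ∑ m ∈ Finset.range (N + 1), coeff m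

theorem coeffSum_apply (N : ℕ) (f : ℝ⟦X⟧) :
    coeffSum N f = ∑ m ∈ Finset.range (N + 1), coeff m f := by
  simp [coeffSum]

theorem HasCoeffDerivAt.coeffSum {f : ℝ → ℝ⟦X⟧} {f' : ℝ⟦X⟧} {t : ℝ}
    (hf : HasCoeffDerivAt f f' t) (N : ℕ) :
    HasDerivAt (fun s => coeffSum N (f s)) (coeffSum N f') t := by
  simp only [coeffSum_apply]
  exact HasDerivAt.fun_sum fun m _ => hf m

end CoeffDeriv

section TaylorFlow

variable {ι : Type*}

/-- The tensor product `v ⊗ w`, with coordinates indexed by pairs. -/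
def tensor (v w : ι → ℝ) : ι × ι → ℝ := fun p => v p.1 * w p.2

/-- The coefficient of degree `m` of the tensor square of the power series `∑ m, u m X ^ m`. -/
def tensorCoeff (u : ℕ → ι → ℝ) (m : ℕ) : ι × ι → ℝ :=
  ∑ q ∈ antidiagonal m, tensor (u q.1) (u q.2)

theorem tensor_zero_left (w : ι → ℝ) : tensor 0 w = 0 := funext fun _ => zero_mul _

theorem tensor_zero_right (v : ι → ℝ) : tensor v 0 = 0 := funext fun _ => mul_zero _

theorem tensor_sub_left (v v' w : ι → ℝ) : tensor (v - v') w = tensor v w - tensor v' w :=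
  funext fun _ => sub_mul _ _ _

theorem tensor_sub_right (v w w' : ι → ℝ) : tensor v (w - w') = tensor v w - tensor v w' :=
  funext fun _ => mul_sub _ _ _

theorem vecNorm1_tensor [Fintype ι] (v w : ι → ℝ) :
    vecNorm1 (tensor v w) = vecNorm1 v * vecNorm1 w := by
  simp only [vecNorm1, tensor, norm_mul, Fintype.sum_prod_type, Finset.sum_mul_sum]

theorem vecNorm1_tensor_le [Fintype ι] {v w : ι → ℝ} {a b : ℝ} (hv : vecNorm1 v ≤ a)
    (hw : vecNorm1 w ≤ b) : vecNorm1 (tensor v w) ≤ a * b :=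
  (vecNorm1_tensor v w).trans_le
    (mul_le_mul hv hw (vecNorm1_nonneg w) ((vecNorm1_nonneg v).trans hv))

theorem vecNorm1_sum_antidiagonal_tensor_le [Fintype ι] {v w : ℕ → ι → ℝ} {a b : ℕ → ℝ}
    {A B c : ℝ} {k : ℕ} (hv : ∀ i ≤ k, vecNorm1 (v i) ≤ a i * (c ^ i * A))
    (hw : ∀ i ≤ k, vecNorm1 (w i) ≤ b i * (c ^ i * B)) :
    vecNorm1 (∑ q ∈ antidiagonal k, tensor (v q.1) (w q.2)) ≤
      (∑ q ∈ antidiagonal k, a q.1 * b q.2) * (c ^ k * (A * B)) := by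
  rw [Finset.sum_mul]
  refine (vecNorm1_sum_le _ _).trans (Finset.sum_le_sum fun q hq => ?_)
  obtain rfl : q.1 + q.2 = k := mem_antidiagonal.1 hq
  exact (vecNorm1_tensor_le (hv _ le_self_add) (hw _ le_add_self)).trans_eq (by ring)

theorem continuous_tensor {f g : ℝ → ι → ℝ} (hf : Continuous f) (hg : Continuous g) :
    Continuous fun t => tensor (f t) (g t) := by
  unfold tensor
  fun_prop

section TensorCoeff

variable {u : ℕ → ι → ℝ}

theorem tensorCoeff_zero (hu : u 0 = 0) : tensorCoeff u 0 = 0 := by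
  simp [tensorCoeff, hu, tensor_zero_left]

theorem tensorCoeff_one (hu : u 0 = 0) : tensorCoeff u 1 = 0 := by
  simp [tensorCoeff, Finset.Nat.antidiagonal_succ, hu, tensor_zero_left, tensor_zero_right]

theorem tensorCoeff_add_two (hu : u 0 = 0) (k : ℕ) :
    tensorCoeff u (k + 2) =
      ∑ q ∈ antidiagonal k, tensor (u (q.1 + 1)) (u (q.2 + 1)) := by
  simp [tensorCoeff, Finset.Nat.antidiagonal_succ_succ', hu, tensor_zero_left, tensor_zero_right]

end TensorCoeff

variable [Fintype ι]

/-- `u t m` is the coefficient of `ε ^ m` in the solution at time `t` of the quadratic equation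
with initial value `ε • xin`. -/
structure IsTaylorFlow (F₁ : Matrix ι ι ℝ) (F₂ : Matrix ι (ι × ι) ℝ) (xin : ι → ℝ)
    (u : ℝ → ℕ → ι → ℝ) : Prop where
  zero (t : ℝ) : u t 0 = 0
  init : u 0 = Pi.single 1 xin
  hasDerivAt (m : ℕ) (t : ℝ) :
    HasDerivAt (fun s => u s m) (F₁ *ᵥ u t m + F₂ *ᵥ tensorCoeff (u t) m) t

section Existence

variable [DecidableEq ι]

/-- The Taylor coefficients of the flow of the quadratic equation, by recursion on the degree:
since the coefficient of degree zero vanishes, the forcing in degree `m + 2` only involves smaller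
degrees. -/
noncomputable def taylorTerm (F₁ : Matrix ι ι ℝ) (F₂ : Matrix ι (ι × ι) ℝ) (xin : ι → ℝ) :
    ℕ → ℝ → ι → ℝ
  | 0 => 0
  | 1 => linearFlow F₁ 0 xin
  | m + 2 => linearFlow F₁ (fun s => F₂ *ᵥ ∑ i : Fin (m + 1),
      tensor (taylorTerm F₁ F₂ xin (i + 1) s) (taylorTerm F₁ F₂ xin (m - i + 1) s)) 0

theorem taylorTerm_add_two (F₁ : Matrix ι ι ℝ) (F₂ : Matrix ι (ι × ι) ℝ) (xin : ι → ℝ) (m : ℕ) :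
    taylorTerm F₁ F₂ xin (m + 2) =
      linearFlow F₁ (fun s => F₂ *ᵥ tensorCoeff (taylorTerm F₁ F₂ xin · s) (m + 2)) 0 := by
  rw [taylorTerm]
  congr
  ext1 s
  rw [tensorCoeff_add_two (by rw [taylorTerm]; rfl),
    Finset.Nat.sum_antidiagonal_eq_sum_range_succ fun i j =>
      tensor (taylorTerm F₁ F₂ xin (i + 1) s) (taylorTerm F₁ F₂ xin (j + 1) s), Finset.sum_range]

theorem continuous_taylorTerm (F₁ : Matrix ι ι ℝ) (F₂ : Matrix ι (ι × ι) ℝ) (xin : ι → ℝ)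
    (m : ℕ) : Continuous (taylorTerm F₁ F₂ xin m) := by
  induction m using Nat.strong_induction_on with
  | _ m ih =>
    match m with
    | 0 => rw [taylorTerm]; exact continuous_zero
    | 1 => rw [taylorTerm]; exact continuous_linearFlow F₁ continuous_zero xin
    | m + 2 =>
      rw [taylorTerm]
      refine continuous_linearFlow F₁ (Continuous.matrix_mulVec continuous_const
        (continuous_finsetSum _ fun i _ => ?_)) 0
      exact continuous_tensor (ih _ (by omega)) (ih _ (by omega))

theorem continuous_tensorCoeff_taylorTerm (F₁ : Matrix ι ι ℝ) (F₂ : Matrix ι (ι × ι) ℝ)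
    (xin : ι → ℝ) (m : ℕ) : Continuous fun t => tensorCoeff (taylorTerm F₁ F₂ xin · t) m :=
  continuous_finsetSum _ fun _ _ =>
    continuous_tensor (continuous_taylorTerm F₁ F₂ xin _) (continuous_taylorTerm F₁ F₂ xin _)

theorem isTaylorFlow_taylorTerm (F₁ : Matrix ι ι ℝ) (F₂ : Matrix ι (ι × ι) ℝ) (xin : ι → ℝ) :
    IsTaylorFlow F₁ F₂ xin fun t m => taylorTerm F₁ F₂ xin m t := by
  have hzero (t : ℝ) : taylorTerm F₁ F₂ xin 0 t = 0 := by rw [taylorTerm]; rfl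
  refine ⟨hzero, funext fun m => ?_, fun m t => ?_⟩
  · match m with
    | 0 => simpa using hzero 0
    | 1 => simp [taylorTerm, linearFlow_zero]
    | m + 2 => simp [taylorTerm, linearFlow_zero]
  · match m with
    | 0 => simpa [hzero, tensorCoeff_zero] using hasDerivAt_const t (0 : ι → ℝ)
    | 1 =>
      rw [tensorCoeff_one (hzero t), mulVec_zero, taylorTerm]
      exact hasDerivAt_linearFlow F₁ continuous_zero xin t
    | m + 2 =>
      rw [taylorTerm_add_two]
      exact hasDerivAt_linearFlow F₁ (Continuous.matrix_mulVec continuous_const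
        (continuous_tensorCoeff_taylorTerm F₁ F₂ xin (m + 2))) 0 t

end Existence

end TaylorFlow

section CarlemanFlow

open PowerSeries

variable {n j N : ℕ} {F₁ : Matrix (Fin n) (Fin n) ℝ} {F₂ : Matrix (Fin n) (Fin n × Fin n) ℝ}
  {xin : Fin n → ℝ} {u : ℝ → ℕ → Fin n → ℝ} {T t : ℝ}

/-- The `i`-th coordinate of the power series with vector coefficients `u m`. -/
def coordSeries (u : ℕ → Fin n → ℝ) (i : Fin n) : ℝ⟦X⟧ := PowerSeries.mk fun m => u m i

/-- The block `j` of the solution of the level-`N` Carleman system: the terms of degree at most `N`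
in the `j`-th tensor power of the power series with coefficients `u t m`. -/
noncomputable def carlemanFlow (N : ℕ) (u : ℝ → ℕ → Fin n → ℝ) (j : ℕ) (t : ℝ) :
    (Fin j → Fin n) → ℝ :=
  fun a => coeffSum N (∏ k, coordSeries (u t) (a k))

theorem coordSeries_mulVec (F₁ : Matrix (Fin n) (Fin n) ℝ) (u : ℕ → Fin n → ℝ) (i : Fin n) :
    coordSeries (fun m => F₁ *ᵥ u m) i = ∑ c, F₁ i c • coordSeries u c := by
  ext m
  simp [coordSeries, mulVec, dotProduct]

theorem coordSeries_mulVec_tensorCoeff (F₂ : Matrix (Fin n) (Fin n × Fin n) ℝ)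
    (u : ℕ → Fin n → ℝ) (i : Fin n) :
    coordSeries (fun m => F₂ *ᵥ tensorCoeff u m) i =
      ∑ p, F₂ i p • (coordSeries u p.1 * coordSeries u p.2) := by
  ext m
  simp [coordSeries, mulVec, dotProduct, tensorCoeff, tensor, coeff_mul]

namespace IsTaylorFlow

theorem hasCoeffDerivAt_prod (hu : IsTaylorFlow F₁ F₂ xin u) (a : Fin j → Fin n) (t : ℝ) :
    HasCoeffDerivAt (fun s => ∏ k, coordSeries (u s) (a k))
      (∑ b, diagBlock F₁ j a b • ∏ k, coordSeries (u t) (b k) +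
        ∑ b, superBlock F₂ j a b • ∏ k, coordSeries (u t) (b k)) t := by
  have hcoord (i : Fin n) : HasCoeffDerivAt (fun s => coordSeries (u s) i)
      (∑ c, F₁ i c • coordSeries (u t) c +
        ∑ p, F₂ i p • (coordSeries (u t) p.1 * coordSeries (u t) p.2)) t := fun m => by
    rw [← coordSeries_mulVec, ← coordSeries_mulVec_tensorCoeff]
    simp only [coordSeries, map_add, coeff_mk]
    exact hasDerivAt_pi.1 (hu.hasDerivAt m t) i
  rw [sum_diagBlock_smul_prod, sum_superBlock_smul_prod, ← Finset.sum_add_distrib]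
  simp only [← add_mul]
  exact .finset_prod fun i _ => hcoord (a i)

theorem hasDerivAt_carlemanFlow (hu : IsTaylorFlow F₁ F₂ xin u) (N j : ℕ) (t : ℝ) :
    HasDerivAt (carlemanFlow N u j)
      (diagBlock F₁ j *ᵥ carlemanFlow N u j t +
        superBlock F₂ j *ᵥ carlemanFlow N u (j + 1) t) t := by
  refine hasDerivAt_pi.2 fun a => ((hu.hasCoeffDerivAt_prod a t).coeffSum N).congr_deriv ?_
  simp [carlemanFlow, mulVec, dotProduct]

theorem coordSeries_init (hu : IsTaylorFlow F₁ F₂ xin u) (i : Fin n) :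
    coordSeries (u 0) i = C (xin i) * X := by
  ext m
  rcases eq_or_ne m 1 with rfl | hm <;> simp [coordSeries, hu.init, coeff_X, *]

theorem carlemanFlow_init (hu : IsTaylorFlow F₁ F₂ xin u) (hj : j ≤ N) :
    carlemanFlow N u j 0 = tensorPow xin j := by
  ext a
  have hprod : ∏ k, coordSeries (u 0) (a k) = C (∏ k, xin (a k)) * X ^ j := by
    simp [hu.coordSeries_init, Finset.prod_mul_distrib]
  simp only [carlemanFlow, hprod, tensorPow, coeffSum_apply, coeff_C_mul_X_pow]
  rw [Finset.sum_ite_eq', if_pos (Finset.mem_range_succ_iff.2 hj)]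

theorem carlemanFlow_eq_zero_of_lt (hu : IsTaylorFlow F₁ F₂ xin u) (hj : N < j) (t : ℝ) :
    carlemanFlow N u j t = 0 := by
  ext a
  have hdvd : X ^ j ∣ ∏ k, coordSeries (u t) (a k) := by
    simpa using Finset.prod_dvd_prod_of_dvd (fun _ => X) (fun k => coordSeries (u t) (a k))
      (s := Finset.univ) fun k _ => X_dvd_iff.2 (by simp [coordSeries, hu.zero])
  rw [carlemanFlow, coeffSum_apply]
  exact Finset.sum_eq_zero fun m hm =>
    X_pow_dvd_iff.1 hdvd m ((Finset.mem_range_succ_iff.1 hm).trans_lt hj)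

variable {y : (j : ℕ) → ℝ → (Fin j → Fin n) → ℝ}

theorem eqOn_carlemanFlow_of_succ (hu : IsTaylorFlow F₁ F₂ xin u)
    (hy : IsCarlemanSolution F₁ F₂ xin N T y) (hj : 1 ≤ j) (hjN : j ≤ N)
    (hsucc : j < N → EqOn (y (j + 1)) (carlemanFlow N u (j + 1)) (Icc 0 T)) :
    EqOn (y j) (carlemanFlow N u j) (Icc 0 T) := by
  obtain ⟨hinit, hderiv⟩ := hy j hj hjN
  refine eqOn_of_hasDerivWithinAt_mulVec_add hderiv (fun t ht => ?_)
    (hinit.trans (hu.carlemanFlow_init hjN).symm)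
  have hforcing : (if j < N then superBlock F₂ j *ᵥ y (j + 1) t else 0) =
      superBlock F₂ j *ᵥ carlemanFlow N u (j + 1) t := by
    split_ifs with h
    · rw [hsucc h ht]
    · rw [hu.carlemanFlow_eq_zero_of_lt (by omega), mulVec_zero]
  rw [hforcing]
  exact (hu.hasDerivAt_carlemanFlow N j t).hasDerivWithinAt

theorem eqOn_carlemanFlow (hu : IsTaylorFlow F₁ F₂ xin u)
    (hy : IsCarlemanSolution F₁ F₂ xin N T y) (hj : 1 ≤ j) (hjN : j ≤ N) :
    EqOn (y j) (carlemanFlow N u j) (Icc 0 T) := by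
  induction hjN using Nat.decreasingInduction with
  | self => exact hu.eqOn_carlemanFlow_of_succ hy hj le_rfl fun h => absurd h (lt_irrefl N)
  | of_succ k hk ih => exact hu.eqOn_carlemanFlow_of_succ hy hj hk.le fun _ => ih (by omega)

theorem firstBlock_eq_sum (hu : IsTaylorFlow F₁ F₂ xin u)
    (hy : IsCarlemanSolution F₁ F₂ xin N T y) (hN : 1 ≤ N) (ht : t ∈ Icc 0 T) :
    firstBlock y t = ∑ m ∈ Finset.range (N + 1), u t m := by
  ext i
  simp [firstBlock, hu.eqOn_carlemanFlow hy le_rfl hN ht, carlemanFlow, coeffSum_apply,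
    coordSeries]

end IsTaylorFlow

end CarlemanFlow

section Catalan

theorem catalan_succ_le_four_pow (k : ℕ) : catalan (k + 1) ≤ 4 ^ k := by
  have hcentral : (k + 2) * catalan (k + 1) = 2 * (2 * k + 1).choose k := by
    rw [succ_mul_catalan_eq_centralBinom, Nat.centralBinom_eq_two_mul_choose, Nat.mul_succ,
      Nat.choose_succ_succ' (2 * k + 1), Nat.choose_symm_half, ← two_mul]
  nlinarith [Nat.choose_middle_le_pow k]

theorem catalan_add_two (k : ℕ) :
    catalan (k + 2) =
      ∑ q ∈ antidiagonal k, catalan q.1 * catalan (q.2 + 1) + catalan (k + 1) := by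
  rw [catalan_succ', Finset.Nat.sum_antidiagonal_succ', catalan_zero, mul_one, add_comm]

end Catalan

section Remainder

variable {ι : Type*}

/-- What is left of `x` after subtracting the terms of degree at most `k` of its expansion. -/
def taylorRemainder (x : ι → ℝ) (u : ℕ → ι → ℝ) (k : ℕ) : ι → ℝ :=
  x - ∑ m ∈ Finset.range (k + 1), u m

variable {u : ℕ → ι → ℝ}

theorem taylorRemainder_zero (x : ι → ℝ) (hu : u 0 = 0) : taylorRemainder x u 0 = x := by
  simp [taylorRemainder, hu]

theorem taylorRemainder_succ (x : ι → ℝ) (u : ℕ → ι → ℝ) (k : ℕ) :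
    taylorRemainder x u (k + 1) = taylorRemainder x u k - u (k + 1) := by
  rw [taylorRemainder, Finset.sum_range_succ, ← sub_sub, taylorRemainder]

/-- Splitting `x ⊗ x` as `∑ i ≤ k, u i ⊗ x + r k ⊗ x` and pairing `u i ⊗ x` with the terms
`u i ⊗ u j`, `i + j ≤ k + 1`, leaves only products with one remainder as a factor. -/
theorem tensor_self_sub_sum_tensorCoeff (x : ι → ℝ) (hu : u 0 = 0) (k : ℕ) :
    tensor x x - ∑ a ∈ Finset.range (k + 2), tensorCoeff u a =
      ∑ q ∈ antidiagonal k, tensor (u q.1) (taylorRemainder x u (q.2 + 1)) +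
        tensor (taylorRemainder x u k) x := by
  induction k with
  | zero =>
    simp [Finset.sum_range_succ, tensorCoeff_zero hu, tensorCoeff_one hu, hu, tensor_zero_left,
      taylorRemainder_zero x hu]
  | succ k ih =>
    have hcoeff : tensorCoeff u (k + 2) = tensor (u (k + 1)) (u 1) +
        ∑ q ∈ antidiagonal k, tensor (u q.1) (u (q.2 + 2)) := by
      rw [tensorCoeff, Finset.Nat.sum_antidiagonal_succ', Finset.Nat.sum_antidiagonal_succ', hu,
        tensor_zero_right, zero_add]
    rw [Finset.sum_range_succ, ← sub_sub, ih, hcoeff, Finset.Nat.sum_antidiagonal_succ']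
    simp only [taylorRemainder_succ x u, zero_add, taylorRemainder_zero x hu, tensor_sub_left,
      tensor_sub_right, Finset.sum_sub_distrib]
    abel

end Remainder

section Bounds

variable {n N : ℕ} {F₁ : Matrix (Fin n) (Fin n) ℝ} {F₂ : Matrix (Fin n) (Fin n × Fin n) ℝ}
  {xin : Fin n → ℝ} {x : ℝ → Fin n → ℝ} {u : ℝ → ℕ → Fin n → ℝ} {K γ T μ ν : ℝ}

/-- The factor by which a forcing `F₂ *ᵥ z` is amplified in the response of a linear equation that
is exponentially stable with constants `K` and `γ`. -/
noncomputable def forcingGain (F₂ : Matrix (Fin n) (Fin n × Fin n) ℝ) (K γ : ℝ) : ℝ :=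
  K * matNorm1 F₂ / γ

theorem IsExpStable.forcingGain_nonneg (hF : IsExpStable F₁ K γ) (hγ : 0 < γ)
    (F₂ : Matrix (Fin n) (Fin n × Fin n) ℝ) : 0 ≤ forcingGain F₂ K γ :=
  div_nonneg (mul_nonneg hF.const_nonneg (matNorm1_nonneg F₂)) hγ.le

theorem IsExpStable.vecNorm1_solution_le_forcingGain_mul (hF : IsExpStable F₁ K γ) (hγ : 0 < γ)
    {v : ℝ → Fin n → ℝ} {z : ℝ → Fin n × Fin n → ℝ} {G t : ℝ}
    (hv : ∀ t ∈ Icc 0 T, HasDerivWithinAt v (F₁ *ᵥ v t + F₂ *ᵥ z t) (Icc 0 T) t)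
    (hz : ∀ t ∈ Icc 0 T, vecNorm1 (z t) ≤ G) (hv₀ : v 0 = 0) (ht : t ∈ Icc 0 T) :
    vecNorm1 (v t) ≤ forcingGain F₂ K γ * G :=
  (hF.vecNorm1_solution_le_div hγ hv (fun t ht => vecNorm1_mulVec_le_of_le F₂ (hz t ht)) hv₀
    ht).trans_eq (by rw [forcingGain]; ring)

namespace IsTaylorFlow

theorem vecNorm1_one_le (hu : IsTaylorFlow F₁ F₂ xin u) (hF : IsExpStable F₁ K γ) (hγ : 0 < γ)
    (hxin : vecNorm1 xin ≤ μ) {t : ℝ} (ht : 0 ≤ t) : vecNorm1 (u t 1) ≤ K * μ := by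
  have hderiv : ∀ s ∈ Icc 0 t,
      HasDerivWithinAt (fun s => u s 1) (F₁ *ᵥ u s 1 + 0) (Icc 0 t) s := fun s _ => by
    simpa only [tensorCoeff_one (hu.zero s), mulVec_zero] using (hu.hasDerivAt 1 s).hasDerivWithinAt
  have hK := hF.const_nonneg
  calc vecNorm1 (u t 1) ≤ K * (Real.exp (-(γ * t)) * vecNorm1 xin) := by
        simpa [hu.init] using hF.vecNorm1_solution_le hγ.ne' hderiv
          (fun _ _ => vecNorm1_zero.le) (right_mem_Icc.2 ht)
    _ ≤ K * vecNorm1 xin := by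
        gcongr
        exact mul_le_of_le_one_left (vecNorm1_nonneg xin)
          (Real.exp_le_one_iff.2 (neg_nonpos.2 (mul_nonneg hγ.le ht)))
    _ ≤ K * μ := by gcongr

theorem vecNorm1_succ_le (hu : IsTaylorFlow F₁ F₂ xin u) (hF : IsExpStable F₁ K γ) (hγ : 0 < γ)
    (hν : ∀ t ∈ Icc 0 T, vecNorm1 (u t 1) ≤ ν) (k : ℕ) :
    ∀ t ∈ Icc 0 T, vecNorm1 (u t (k + 1)) ≤ catalan k * ((forcingGain F₂ K γ * ν) ^ k * ν) := by
  induction k using Nat.strong_induction_on with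
  | _ k ih =>
    match k with
    | 0 => simpa using hν
    | k + 1 =>
      have hforcing : ∀ t ∈ Icc 0 T, vecNorm1 (tensorCoeff (u t) (k + 2)) ≤
          catalan (k + 1) * ((forcingGain F₂ K γ * ν) ^ k * (ν * ν)) := fun t ht => by
        rw [tensorCoeff_add_two (hu.zero t), catalan_succ']
        push_cast
        exact vecNorm1_sum_antidiagonal_tensor_le (v := fun i => u t (i + 1))
          (w := fun i => u t (i + 1)) (fun i hi => ih i (by omega) t ht)
          (fun i hi => ih i (by omega) t ht)
      exact fun t ht => (hF.vecNorm1_solution_le_forcingGain_mul hγ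
        (fun t _ => (hu.hasDerivAt (k + 2) t).hasDerivWithinAt) hforcing
        (by simp [hu.init]) ht).trans_eq (by ring)

theorem taylorRemainder_succ_init (hu : IsTaylorFlow F₁ F₂ xin u) (hx : x 0 = xin) (k : ℕ) :
    taylorRemainder (x 0) (u 0) (k + 1) = 0 := by
  simp [taylorRemainder, hu.init, hx, Finset.sum_pi_single']

theorem hasDerivWithinAt_taylorRemainder (hu : IsTaylorFlow F₁ F₂ xin u)
    (hx : IsQuadraticSolution F₁ F₂ xin T x) (k : ℕ) {t : ℝ} (ht : t ∈ Icc 0 T) :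
    HasDerivWithinAt (fun t => taylorRemainder (x t) (u t) (k + 1))
      (F₁ *ᵥ taylorRemainder (x t) (u t) (k + 1) +
        F₂ *ᵥ (∑ q ∈ antidiagonal k, tensor (u t q.1) (taylorRemainder (x t) (u t) (q.2 + 1)) +
          tensor (taylorRemainder (x t) (u t) k) (x t))) (Icc 0 T) t := by
  rw [← tensor_self_sub_sum_tensorCoeff (x t) (hu.zero t)]
  refine ((hx.2 t ht).fun_sub (HasDerivWithinAt.fun_sum fun m _ =>
    (hu.hasDerivAt m t).hasDerivWithinAt)).congr_deriv ?_
  rw [taylorRemainder, mulVec_sub, mulVec_sub, mulVec_sum, mulVec_sum, Finset.sum_add_distrib,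
    add_sub_add_comm]
  rfl

theorem hasDerivWithinAt_taylorRemainder_one (hu : IsTaylorFlow F₁ F₂ xin u)
    (hx : IsQuadraticSolution F₁ F₂ xin T x) {t : ℝ} (ht : t ∈ Icc 0 T) :
    HasDerivWithinAt (fun t => taylorRemainder (x t) (u t) 1)
      (F₁ *ᵥ taylorRemainder (x t) (u t) 1 + F₂ *ᵥ tensor (x t) (x t)) (Icc 0 T) t := by
  simpa [hu.zero, tensor_zero_left, taylorRemainder_zero] using
    hu.hasDerivWithinAt_taylorRemainder hx 0 ht

theorem vecNorm1_one_le_add (hu : IsTaylorFlow F₁ F₂ xin u) (hF : IsExpStable F₁ K γ)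
    (hγ : 0 < γ) (hx : IsQuadraticSolution F₁ F₂ xin T x)
    (hμ : ∀ t ∈ Icc 0 T, vecNorm1 (x t) ≤ μ) {t : ℝ} (ht : t ∈ Icc 0 T) :
    vecNorm1 (u t 1) ≤ μ + forcingGain F₂ K γ * (μ * μ) := by
  have hone : u t 1 = x t - taylorRemainder (x t) (u t) 1 := by
    rw [taylorRemainder_succ, taylorRemainder_zero _ (hu.zero t), zero_add, sub_sub_cancel]
  rw [hone]
  exact (vecNorm1_sub_le _ _).trans <| add_le_add (hμ t ht) <|
    hF.vecNorm1_solution_le_forcingGain_mul hγ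
      (fun t ht => hu.hasDerivWithinAt_taylorRemainder_one hx ht)
      (fun t ht => vecNorm1_tensor_le (hμ t ht) (hμ t ht)) (hu.taylorRemainder_succ_init hx.1 0) ht

theorem vecNorm1_taylorRemainder_le (hu : IsTaylorFlow F₁ F₂ xin u) (hF : IsExpStable F₁ K γ)
    (hγ : 0 < γ) (hx : IsQuadraticSolution F₁ F₂ xin T x)
    (hμ : ∀ t ∈ Icc 0 T, vecNorm1 (x t) ≤ μ) (hxν : ∀ t ∈ Icc 0 T, vecNorm1 (x t) ≤ ν)
    (hν : ∀ t ∈ Icc 0 T, vecNorm1 (u t 1) ≤ ν) (k : ℕ) :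
    ∀ t ∈ Icc 0 T, vecNorm1 (taylorRemainder (x t) (u t) (k + 1)) ≤
      catalan (k + 1) * ((forcingGain F₂ K γ * ν) ^ k * (K * (matNorm1 F₂ * (μ * μ)) * T)) := by
  set M := K * (matNorm1 F₂ * (μ * μ)) * T
  induction k using Nat.strong_induction_on with
  | _ k ih =>
    match k with
    | 0 =>
      intro t ht
      simpa using hF.vecNorm1_solution_le_mul hγ
        (fun t ht => hu.hasDerivWithinAt_taylorRemainder_one hx ht)
        (fun t ht => vecNorm1_mulVec_le_of_le F₂ (vecNorm1_tensor_le (hμ t ht) (hμ t ht)))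
        (hu.taylorRemainder_succ_init hx.1 0) ht
    | k + 1 =>
      have hforcing : ∀ t ∈ Icc 0 T,
          vecNorm1 (∑ q ∈ antidiagonal (k + 1),
            tensor (u t q.1) (taylorRemainder (x t) (u t) (q.2 + 1)) +
              tensor (taylorRemainder (x t) (u t) (k + 1)) (x t)) ≤
            catalan (k + 2) * ((forcingGain F₂ K γ * ν) ^ k * (ν * M)) := fun t ht => by
        rw [Finset.Nat.sum_antidiagonal_succ, hu.zero t, tensor_zero_left, zero_add,
          catalan_add_two]
        push_cast
        rw [add_mul]
        refine (vecNorm1_add_le _ _).trans (add_le_add ?_ ?_)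
        · exact vecNorm1_sum_antidiagonal_tensor_le (v := fun i => u t (i + 1))
            (w := fun i => taylorRemainder (x t) (u t) (i + 1))
            (fun i _ => hu.vecNorm1_succ_le hF hγ hν i t ht) (fun i hi => ih i (by omega) t ht)
        · exact (vecNorm1_tensor_le (ih k k.lt_succ_self t ht) (hxν t ht)).trans_eq (by ring)
      exact fun t ht => (hF.vecNorm1_solution_le_forcingGain_mul hγ
        (fun t ht => hu.hasDerivWithinAt_taylorRemainder hx (k + 1) ht) hforcing
        (hu.taylorRemainder_succ_init hx.1 (k + 1)) ht).trans_eq (by ring)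

variable {y : (j : ℕ) → ℝ → (Fin j → Fin n) → ℝ}

theorem vecNorm1_sub_firstBlock_le (hu : IsTaylorFlow F₁ F₂ xin u) (hF : IsExpStable F₁ K γ)
    (hγ : 0 < γ) (hT : 0 ≤ T) (hx : IsQuadraticSolution F₁ F₂ xin T x)
    (hμ : ∀ t ∈ Icc 0 T, vecNorm1 (x t) ≤ μ) (hxν : ∀ t ∈ Icc 0 T, vecNorm1 (x t) ≤ ν)
    (hν : ∀ t ∈ Icc 0 T, vecNorm1 (u t 1) ≤ ν) (hN : 1 ≤ N)
    (hy : IsCarlemanSolution F₁ F₂ xin N T y) :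
    vecNorm1 (x T - firstBlock y T) ≤
      K * matNorm1 F₂ * μ ^ 2 * T * (4 * (forcingGain F₂ K γ * ν)) ^ (N - 1) := by
  have hTmem : T ∈ Icc 0 T := right_mem_Icc.2 hT
  have hK := hF.const_nonneg
  have hF₂ := matNorm1_nonneg F₂
  have hβ := hF.forcingGain_nonneg hγ F₂
  have hν₀ : 0 ≤ ν := (vecNorm1_nonneg _).trans (hν T hTmem)
  have hμ₀ : 0 ≤ μ := (vecNorm1_nonneg _).trans (hμ T hTmem)
  obtain ⟨k, rfl⟩ : ∃ k, N = k + 1 := ⟨N - 1, by omega⟩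
  rw [hu.firstBlock_eq_sum hy hN hTmem, add_tsub_cancel_right]
  calc _ ≤ catalan (k + 1) * ((forcingGain F₂ K γ * ν) ^ k *
        (K * (matNorm1 F₂ * (μ * μ)) * T)) :=
        hu.vecNorm1_taylorRemainder_le hF hγ hx hμ hxν hν k T hTmem
    _ ≤ 4 ^ k * ((forcingGain F₂ K γ * ν) ^ k * (K * (matNorm1 F₂ * (μ * μ)) * T)) := by
        gcongr
        exact_mod_cast catalan_succ_le_four_pow k
    _ = _ := by rw [mul_pow]; ring

end IsTaylorFlow

variable {y : (j : ℕ) → ℝ → (Fin j → Fin n) → ℝ}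

theorem IsCarlemanSolution.vecNorm1_sub_firstBlock_le_add
    (hy : IsCarlemanSolution F₁ F₂ xin N T y) (hN : 1 ≤ N) (hF : IsExpStable F₁ K γ)
    (hγ : 0 < γ) (hT : 0 ≤ T) (hx : IsQuadraticSolution F₁ F₂ xin T x)
    (hμ : ∀ t ∈ Icc 0 T, vecNorm1 (x t) ≤ μ) :
    vecNorm1 (x T - firstBlock y T) ≤ K * matNorm1 F₂ * μ ^ 2 * T *
      (4 * (forcingGain F₂ K γ * (μ + forcingGain F₂ K γ * (μ * μ)))) ^ (N - 1) := by
  have hu := isTaylorFlow_taylorTerm F₁ F₂ xin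
  refine hu.vecNorm1_sub_firstBlock_le hF hγ hT hx hμ (fun t ht => (hμ t ht).trans ?_)
    (fun t ht => hu.vecNorm1_one_le_add hF hγ hx hμ ht) hN hy
  exact le_add_of_nonneg_right (mul_nonneg (hF.forcingGain_nonneg hγ F₂) (mul_self_nonneg μ))

theorem IsCarlemanSolution.vecNorm1_sub_firstBlock_le_mul
    (hy : IsCarlemanSolution F₁ F₂ xin N T y) (hN : 1 ≤ N) (hF : IsExpStable F₁ K γ)
    (hγ : 0 < γ) (hT : 0 ≤ T) (hx : IsQuadraticSolution F₁ F₂ xin T x)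
    (hμ : ∀ t ∈ Icc 0 T, vecNorm1 (x t) ≤ μ) :
    vecNorm1 (x T - firstBlock y T) ≤ K * matNorm1 F₂ * μ ^ 2 * T *
      (4 * (forcingGain F₂ K γ * (K * μ))) ^ (N - 1) := by
  have hu := isTaylorFlow_taylorTerm F₁ F₂ xin
  have hxin : vecNorm1 xin ≤ μ := hx.1 ▸ hμ 0 (left_mem_Icc.2 hT)
  exact hu.vecNorm1_sub_firstBlock_le hF hγ hT hx hμ
    (fun t ht => (hF.vecNorm1_le_const_mul (x t)).trans
      (mul_le_mul_of_nonneg_left (hμ t ht) hF.const_nonneg))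
    (fun t ht => hu.vecNorm1_one_le hF hγ hxin ht.1) hN hy

end Bounds

section Rate

theorem resRate_eq {n : ℕ} (W : Matrix (Fin n) (Fin n) ℂ) (lam : Fin n → ℂ)
    (F₂ : Matrix (Fin n) (Fin n × Fin n) ℝ) (μ : ℝ) :
    resRate W lam F₂ μ =
      2 * Real.exp 1 * (forcingGain F₂ (condNum1 W) (resonanceParam lam / 2) * μ) := by
  rw [resRate, forcingGain, div_div_eq_mul_div]
  ring

theorem four_mul_le_two_mul_exp_one_mul {z : ℝ} (hz : 0 ≤ z) : 4 * z ≤ 2 * Real.exp 1 * z := by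
  gcongr
  linarith [Real.exp_one_gt_d9]

theorem four_mul_mul_one_add_le_two_mul_exp_one_mul {z : ℝ} (hz : 0 ≤ z)
    (h : 2 * Real.exp 1 * z ≤ 1) : 4 * (z * (1 + z)) ≤ 2 * Real.exp 1 * z := by
  have he := Real.exp_one_gt_d9
  have hz_le : 4 * z ≤ 1 := (four_mul_le_two_mul_exp_one_mul hz).trans h
  nlinarith

theorem le_natCast_mul_mul_pow {N : ℕ} {a c p q : ℝ} (hN : 1 ≤ N) (ha : a ≤ c * p ^ (N - 1))
    (hc : 0 ≤ c) (hp : 0 ≤ p) (hpq : p ≤ q) : a ≤ N * c * q ^ (N - 1) := by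
  refine ha.trans ?_
  gcongr
  exact le_mul_of_one_le_left hc (by exact_mod_cast hN)

end Rate

end Carleman

theorem mainTheorem1 {n N : ℕ} (hN : 1 ≤ N)
    (F₁ : Matrix (Fin n) (Fin n) ℝ) (F₂ : Matrix (Fin n) (Fin n × Fin n) ℝ)
    (W : Matrix (Fin n) (Fin n) ℂ) (lam : Fin n → ℂ)
    (hW : IsUnit W.det)
    (hF₁ : F₁.map (fun r : ℝ => (r : ℂ)) = W * Matrix.diagonal lam * W⁻¹)
    (hre : ∀ k, (lam k).re ≤ 0)
    (hΔ : 0 < Carleman.resonanceParam lam)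
    (T μ : ℝ) (hT : 0 ≤ T) (xin : Fin n → ℝ)
    (x : ℝ → Fin n → ℝ) (hx : Carleman.IsQuadraticSolution F₁ F₂ xin T x)
    (hμ : ∀ t ∈ Set.Icc 0 T, Carleman.vecNorm1 (x t) ≤ μ)
    (y : (j : ℕ) → ℝ → (Fin j → Fin n) → ℝ)
    (hy : Carleman.IsCarlemanSolution F₁ F₂ xin N T y) :
    (Carleman.resRate W lam F₂ μ ≤ 1 →
      Carleman.vecNorm1 (x T - Carleman.firstBlock y T) ≤
        N * Carleman.errConst W F₂ μ * T * Carleman.resRate W lam F₂ μ ^ (N - 1)) ∧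
    Carleman.vecNorm1 (x T - Carleman.firstBlock y T) ≤
      N * Carleman.errConst W F₂ μ * T *
        (Carleman.condNum1 W * Carleman.resRate W lam F₂ μ) ^ (N - 1) := by
  open Carleman in
  have hF := isExpStable_of_eq_conj_diagonal hW hF₁
    (re_eigenvalue_le_neg_half_resonanceParam hW hF₁ hre)
  have hγ := half_pos hΔ
  have hK := hF.const_nonneg
  have hF₂ := matNorm1_nonneg F₂
  have hβ := hF.forcingGain_nonneg hγ F₂
  have hμ₀ : 0 ≤ μ := (vecNorm1_nonneg _).trans (hμ T (Set.right_mem_Icc.2 hT))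
  have hC : 0 ≤ errConst W F₂ μ * T := by unfold errConst; positivity
  have hz := mul_nonneg hβ hμ₀
  rw [mul_assoc (N : ℝ), resRate_eq]
  refine ⟨fun hR => ?_, ?_⟩
  · refine le_natCast_mul_mul_pow hN (hy.vecNorm1_sub_firstBlock_le_add hN hF hγ hT hx hμ) hC
      (by positivity) ((le_of_eq ?_).trans (four_mul_mul_one_add_le_two_mul_exp_one_mul hz hR))
    ring
  · refine le_natCast_mul_mul_pow hN (hy.vecNorm1_sub_firstBlock_le_mul hN hF hγ hT hx hμ) hC
      (by positivity) ((le_of_eq ?_).trans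
        (mul_le_mul_of_nonneg_left (four_mul_le_two_mul_exp_one_mul hz) hK))
    ring
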